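/- For each integer $i\ge 1$ fix a primitive complex $i$-th root of unity $\zeta_i$. Let $n\ge 2$. For a partition $\lambda\vdash n$ let $x$ be any permutation in $S_n$ of cycle type $\lambda$, and let $a_i$ be the number of parts of $\lambda$ of size $i$. The centralizer $Z_x$ of $x$ in $S_n$ is isomorphic to $\prod_{i\ge 1} G_i\wr S_{a_i}$, where $G_i$ is cyclic of order $i$, generated by a cycle of $x$ of length $i$. Let $\omega^x$ be the linear character of $Z_x$ which, for each $i$, sends the generator of every copy of $G_i$ to $\zeta_i$ and is trivial on the wreathing group $S_{a_i}$. The higher Lie character $\psi^\lambda_{S_n}$ is the character of $S_n$ induced from $\omega^x$, and $\dim\psi^\lambda_{S_n}$ is the dimension of the representation of $S_n$ affording it. Let $\mathrm{OP}(n)$ be the set of partitions of $n$ with odd parts only. Let $\mathrm{EP}(n)$ be, for even $n$, the set of partitions of $n$ with even parts only and, for odd $n$, the set of partitions of $n$ with all parts even except for a single part of size $1$. Then $$\sum_{\lambda\in \mathrm{OP}(n)}\dim\psi^\lambda_{S_n}=\sum_{\lambda\in \mathrm{EP}(n)}\dim\psi^\lambda_{S_n}=\begin{cases}(n-1)!!^{\,2},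 & n \text{ even},\\ n!!\cdot (n-2)!!, & n\text{ odd},\end{cases}$$ where $m!!=m(m-2)(m-4)\cdots$ is the double factorial, the product ending in $1$ or $2$. -/

import Mathlib

/-!
Higher Lie characters of the symmetric group, with values in `ℂ`.

Throughout, `ζ i` is a primitive `i`-th root of unity for each `i ≥ 1`; it is the value, at the
generator, of the chosen primitive irreducible character of the cyclic group of order `i`.
-/

noncomputable section

namespace HigherLie

variable {α : Type*}

/-- `ζ` is a choice, for every `i ≥ 1`, of a primitive complex `i`-th root of unity. -/
def IsRootSystem (ζ : ℕ → ℂ) : Prop := ∀ i, 0 < i → IsPrimitiveRoot (ζ i) i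

open Classical in
/-- If `q = x ^ k p`, and the cycle of `x` through `p` has length `i`, this is `ζ i ^ k`
(it does not depend on `k`, see `weight_eq`). The value `1` for points in different cycles is
never used. -/
def weight (ζ : ℕ → ℂ) (x : Equiv.Perm α) (p q : α) : ℂ :=
  if h : x.SameCycle p q then ζ (Function.minimalPeriod x p) ^ h.choose else 1

/-- The set of cycles of `x`, fixed points included. -/
def Cycles (x : Equiv.Perm α) : Type _ := Quotient (Equiv.Perm.SameCycle.setoid x)

/-- The cycle of `x` through the point `p`. -/
def cycleAt (x : Equiv.Perm α) (p : α) : Cycles x :=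
  Quotient.mk (Equiv.Perm.SameCycle.setoid x) p

/-- A base point on each cycle of `x`. -/
def base {x : Equiv.Perm α} (c : Cycles x) : α := Quotient.out c

theorem cycleAt_eq_iff {x : Equiv.Perm α} {p q : α} :
    cycleAt x p = cycleAt x q ↔ x.SameCycle p q :=
  ⟨fun h => Quotient.exact h, fun h => Quotient.sound h⟩

@[simp]
theorem cycleAt_base {x : Equiv.Perm α} (c : Cycles x) : cycleAt x (base c) = c :=
  Quotient.out_eq c

instance [Finite α] (x : Equiv.Perm α) : Finite (Cycles x) :=
  inferInstanceAs (Finite (Quotient (Equiv.Perm.SameCycle.setoid x)))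

instance [Finite α] (x : Equiv.Perm α) : Fintype (Cycles x) := Fintype.ofFinite _

theorem commute_zpow_apply {x y : Equiv.Perm α} (h : y * x = x * y) (k : ℤ) (p : α) :
    y ((x ^ k) p) = (x ^ k) (y p) := by
  have := (Commute.zpow_right (show Commute y x from h) k).eq
  exact congrArg (fun f : Equiv.Perm α => f p) this

theorem minimalPeriod_of_commute {x y : Equiv.Perm α} (h : y * x = x * y) (p : α) :
    Function.minimalPeriod x (y p) = Function.minimalPeriod x p := by
  rw [Function.minimalPeriod_eq_minimalPeriod_iff]
  intro n
  have := commute_zpow_apply h n p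
  simp only [zpow_natCast] at this
  simp only [Function.IsPeriodicPt, Function.IsFixedPt, ← Equiv.Perm.coe_pow, ← this,
    y.injective.eq_iff]

theorem sameCycle_of_commute {x y : Equiv.Perm α} (h : y * x = x * y) {p q : α}
    (hpq : x.SameCycle p q) : x.SameCycle (y p) (y q) := by
  obtain ⟨k, rfl⟩ := hpq
  exact ⟨k, (commute_zpow_apply h k p).symm⟩

theorem primitive [Finite α] {ζ : ℕ → ℂ} (hζ : IsRootSystem ζ) (x : Equiv.Perm α) (p : α) :
    IsPrimitiveRoot (ζ (Function.minimalPeriod x p)) (Function.minimalPeriod x p) :=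
  hζ _ (Function.minimalPeriod_pos_of_mem_periodicPts
    (Function.Injective.mem_periodicPts x.injective p))

theorem root_ne_zero [Finite α] {ζ : ℕ → ℂ} (hζ : IsRootSystem ζ) (x : Equiv.Perm α) (p : α) :
    ζ (Function.minimalPeriod x p) ≠ 0 := by
  have hpos := Function.minimalPeriod_pos_of_mem_periodicPts
    (Function.Injective.mem_periodicPts x.injective p)
  exact (primitive hζ x p).ne_zero hpos.ne'

theorem weight_eq [Finite α] {ζ : ℕ → ℂ} (hζ : IsRootSystem ζ) (x : Equiv.Perm α) (p : α)
    (k : ℤ) : weight ζ x p ((x ^ k) p) = ζ (Function.minimalPeriod x p) ^ k := by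
  have h : x.SameCycle p ((x ^ k) p) := ⟨k, rfl⟩
  have h0 := root_ne_zero hζ x p
  rw [weight, dif_pos h]
  have hc := h.choose_spec
  generalize h.choose = m at hc
  have hfix : (x ^ (m - k)) p = p := by
    rw [sub_eq_neg_add, zpow_add, Equiv.Perm.mul_apply, hc, ← Equiv.Perm.mul_apply, ← zpow_add]
    simp
  have hdvd : ((Function.minimalPeriod x p : ℕ) : ℤ) ∣ m - k :=
    (MulAction.zpow_smul_eq_iff_minimalPeriod_dvd (a := x) (b := p)).1 hfix
  have h1 := ((primitive hζ x p).zpow_eq_one_iff_dvd _).2 hdvd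
  rw [zpow_sub₀ h0, div_eq_one_iff_eq (zpow_ne_zero _ h0)] at h1
  exact h1

theorem weight_self [Finite α] {ζ : ℕ → ℂ} (hζ : IsRootSystem ζ) (x : Equiv.Perm α) (p : α) :
    weight ζ x p p = 1 := by
  simpa using weight_eq hζ x p 0

theorem weight_mul [Finite α] {ζ : ℕ → ℂ} (hζ : IsRootSystem ζ) {x : Equiv.Perm α} {p q r : α}
    (hpq : x.SameCycle p q) (hqr : x.SameCycle q r) :
    weight ζ x p q * weight ζ x q r = weight ζ x p r := by
  obtain ⟨k, rfl⟩ := hpq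
  obtain ⟨m, rfl⟩ := hqr
  have hcomm : x ^ k * x = x * x ^ k := (Commute.zpow_left (Commute.refl x) k).eq
  rw [weight_eq hζ, weight_eq hζ, minimalPeriod_of_commute hcomm, ← Equiv.Perm.mul_apply,
    ← zpow_add, weight_eq hζ, ← zpow_add₀ (root_ne_zero hζ x p), add_comm]

theorem weight_commute [Finite α] {ζ : ℕ → ℂ} (hζ : IsRootSystem ζ) {x y : Equiv.Perm α}
    (h : y * x = x * y) {p q : α} (hpq : x.SameCycle p q) :
    weight ζ x (y p) (y q) = weight ζ x p q := by
  obtain ⟨k, rfl⟩ := hpq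
  rw [commute_zpow_apply h, weight_eq hζ, weight_eq hζ, minimalPeriod_of_commute h]

/-- The action of the centralizer of `x` on the cycles of `x`. -/
def moveCycle {x : Equiv.Perm α} (z : Equiv.Perm α) (c : Cycles x) : Cycles x :=
  cycleAt x (z (base c))

theorem moveCycle_cycleAt {x z : Equiv.Perm α} (h : z * x = x * z) (p : α) :
    moveCycle z (cycleAt x p) = cycleAt x (z p) :=
  cycleAt_eq_iff.2 (sameCycle_of_commute h (cycleAt_eq_iff.1 (cycleAt_base _)))

theorem moveCycle_bijective [Finite α] {x z : Equiv.Perm α} (h : z * x = x * z) :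
    Function.Bijective (moveCycle z : Cycles x → Cycles x) := by
  refine Finite.surjective_iff_bijective.1 fun c => ⟨cycleAt x (z⁻¹ (base c)), ?_⟩
  rw [moveCycle_cycleAt h]
  simp

/-- Let `x` have `a i` cycles of length `i`. The choice of base points identifies the centralizer
of `x` with the product over `i` of the wreath products of the cyclic group of order `i` with the
symmetric group on `a i` letters: `z` sends the cycle `c` to a cycle `c'`, and the base point of
`c` to the point `x ^ k` (base point of `c'`), so the component of `z` in the cyclic group attached
to the cycle is the `k`-th power of the generator, and the elements that carry base points to base
points form the wreathing groups. Hence the linear character that is the primitive character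
`generator ↦ ζ i` on each cyclic factor of order `i`, and trivial on the wreathing groups, has the
value at `z` which is the product of all these `ζ i ^ k`. -/
def omegaFun (ζ : ℕ → ℂ) (x z : Equiv.Perm α) [Finite α] : ℂ :=
  ∏ c : Cycles x, weight ζ x (base (moveCycle z c)) (z (base c))

/-- The linear character `ω^x` of the centralizer of `x`. -/
def omega [Finite α] {ζ : ℕ → ℂ} (hζ : IsRootSystem ζ) (x : Equiv.Perm α) :
    Subgroup.centralizer {x} →* ℂ where
  toFun z := omegaFun ζ x z
  map_one' := by
    refine Finset.prod_eq_one fun c _ => ?_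
    simp [moveCycle, weight_self hζ]
  map_mul' z w := by
    have hz := Subgroup.mem_centralizer_singleton_iff.1 z.2
    have hw := Subgroup.mem_centralizer_singleton_iff.1 w.2
    have hmove (c : Cycles x) : moveCycle ((z : Equiv.Perm α) * (w : Equiv.Perm α)) c
        = moveCycle (z : Equiv.Perm α) (moveCycle (w : Equiv.Perm α) c) := by
      exact (moveCycle_cycleAt hz ((w : Equiv.Perm α) (base c))).symm
    have hbase (c : Cycles x) :
        x.SameCycle (base (moveCycle (w : Equiv.Perm α) c)) ((w : Equiv.Perm α) (base c)) :=
      cycleAt_eq_iff.1 (cycleAt_base _)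
    have hbase' (c : Cycles x) :
        x.SameCycle (base (moveCycle (z : Equiv.Perm α) c)) ((z : Equiv.Perm α) (base c)) :=
      cycleAt_eq_iff.1 (cycleAt_base _)
    simp only [omegaFun, Subgroup.coe_mul]
    rw [← (moveCycle_bijective hw).prod_comp fun c =>
      weight ζ x (base (moveCycle (z : Equiv.Perm α) c)) ((z : Equiv.Perm α) (base c)),
      ← Finset.prod_mul_distrib]
    refine Finset.prod_congr rfl fun c _ => ?_
    rw [hmove, Equiv.Perm.mul_apply, ← weight_commute hζ hz (hbase c)]
    exact (weight_mul hζ (hbase' _) (sameCycle_of_commute hz (hbase c))).symm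

/-- The value of `ω^x` does not depend on the base points: any other choice `b` of them gives the
same product. -/
theorem omega_eq_of_base [Finite α] {ζ : ℕ → ℂ} (hζ : IsRootSystem ζ) (x : Equiv.Perm α)
    (b : Cycles x → α) (hb : ∀ c, cycleAt x (b c) = c) (z : Subgroup.centralizer {x}) :
    omega hζ x z = ∏ c : Cycles x, weight ζ x
      (b (cycleAt x ((z : Equiv.Perm α) (b c)))) ((z : Equiv.Perm α) (b c)) := by
  have hz := Subgroup.mem_centralizer_singleton_iff.1 z.2
  have hs (c : Cycles x) : x.SameCycle (base c) (b c) :=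
    cycleAt_eq_iff.1 ((cycleAt_base c).trans (hb c).symm)
  have hm (c : Cycles x) : cycleAt x ((z : Equiv.Perm α) (b c))
      = moveCycle (z : Equiv.Perm α) c := by
    rw [← moveCycle_cycleAt hz, hb]
  have hbase (c : Cycles x) :
      x.SameCycle (base (moveCycle (z : Equiv.Perm α) c)) ((z : Equiv.Perm α) (base c)) :=
    cycleAt_eq_iff.1 (cycleAt_base _)
  have key (c : Cycles x) : weight ζ x (b (cycleAt x ((z : Equiv.Perm α) (b c))))
      ((z : Equiv.Perm α) (b c))
      = weight ζ x (b (moveCycle (z : Equiv.Perm α) c)) (base (moveCycle (z : Equiv.Perm α) c))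
        * weight ζ x (base (moveCycle (z : Equiv.Perm α) c)) ((z : Equiv.Perm α) (base c))
        * weight ζ x (base c) (b c) := by
    rw [hm, weight_mul hζ (hs _).symm (hbase c), ← weight_commute hζ hz (hs c)]
    exact (weight_mul hζ ((hs _).symm.trans (hbase c)) (sameCycle_of_commute hz (hs c))).symm
  simp only [key, Finset.prod_mul_distrib]
  rw [(moveCycle_bijective hz).prod_comp fun c => weight ζ x (b c) (base c), mul_right_comm,
    ← Finset.prod_mul_distrib]
  simp only [weight_mul hζ (hs _).symm (hs _), weight_self hζ, Finset.prod_const_one, one_mul]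
  rfl

/-- The one-dimensional representation of the centralizer of `x` on `ℂ` with character `ω^x`. -/
def omegaRep [Finite α] {ζ : ℕ → ℂ} (hζ : IsRootSystem ζ) (x : Equiv.Perm α) :
    Representation ℂ (Subgroup.centralizer {x}) ℂ :=
  (Algebra.lmul ℂ ℂ : ℂ →* Module.End ℂ ℂ).comp (omega hζ x)

/-- The space of the representation induced from `ω^x`. -/
abbrev HigherLieModule [Finite α] {ζ : ℕ → ℂ} (hζ : IsRootSystem ζ) (x : Equiv.Perm α) :
    Type _ :=
  Representation.IndV (Subgroup.centralizer {x}).subtype (omegaRep hζ x)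

/-- The representation of the symmetric group induced from `ω^x`. -/
def higherLieRep [Finite α] {ζ : ℕ → ℂ} (hζ : IsRootSystem ζ) (x : Equiv.Perm α) :
    Representation ℂ (Equiv.Perm α) (HigherLieModule hζ x) :=
  Representation.ind (Subgroup.centralizer {x}).subtype (omegaRep hζ x)

/-- The higher Lie character `ψ^x`, the character induced from `ω^x`. -/
def higherLieCharacter [Finite α] {ζ : ℕ → ℂ} (hζ : IsRootSystem ζ) (x : Equiv.Perm α) :
    Equiv.Perm α → ℂ :=
  (higherLieRep hζ x).character

/-- The dimension of `ψ^x`, that is, of the representation with this character. -/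
def higherLieDim [Finite α] {ζ : ℕ → ℂ} (hζ : IsRootSystem ζ) (x : Equiv.Perm α) : ℕ :=
  Module.finrank ℂ (HigherLieModule hζ x)

theorem higherLieCharacter_one [Finite α] {ζ : ℕ → ℂ} (hζ : IsRootSystem ζ)
    (x : Equiv.Perm α) : higherLieCharacter hζ x 1 = higherLieDim hζ x :=
  Representation.char_one _

end HigherLie

open Classical in
/-- The partitions of `n` with even parts only (`n` even), or with all parts even except for a
single part of size `1` (`n` odd). -/
def evensPartition (n : ℕ) : Finset n.Partition :=
  Finset.univ.filter fun l =>
    if Even n then ∀ i ∈ l.parts, Even i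
    else l.parts.count 1 = 1 ∧ ∀ i ∈ l.parts, i ≠ 1 → Even i

end

/-! Since `ω^x` is linear, `ψ^λ` has degree the index of the centralizer, so each sum counts the
permutations whose cycle type lies in the given set. Divided by `n!`, the counts become densities,
and double counting over the removal of one part gives `n d(n) = ∑ d(n - i)` over admissible lengths
`i ≤ n` (`mul_cycleDensity`). This is the coefficient form of `F = exp (∑ t^i / i)`. For even
lengths `F = (1 - t^2)^(-1/2)`; for odd lengths `F = (1 + t)(1 - t^2)^(-1/2)`. Hence the odd
densities at `2m` and `2m + 1` both equal the even density at `2m` (`cycleDensity_odd`), which is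
`(2m - 1)‼^2 / (2m)!`. Adjoining a single fixed point to even cycles leaves the centralizer order
unchanged, which settles odd `n`. -/

namespace Representation

/-! ### Dimension of an induced representation. -/

variable {k G A : Type*} [CommRing k] [Group G] [AddCommGroup A] [Module k A]

/-- The element `s` of the subgroup `S` with `g = s * r`, where `r` is the chosen representative
of the right coset of `g`. -/
noncomputable def rightCosetPart (S : Subgroup G) (g : G) : S :=
  ⟨g * (Quotient.mk (QuotientGroup.rightRel S) g).out⁻¹, by
    have h := Quotient.mk_out (s := QuotientGroup.rightRel S) g
    exact QuotientGroup.rightRel_apply.1 h⟩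

lemma rightCosetPart_mul_out (S : Subgroup G) (g : G) :
    (rightCosetPart S g : G) * (Quotient.mk (QuotientGroup.rightRel S) g).out = g := by
  simp [rightCosetPart]

lemma mk_rightRel_mul (S : Subgroup G) (s : S) (g : G) :
    Quotient.mk (QuotientGroup.rightRel S) ((s : G) * g) = Quotient.mk _ g :=
  Quotient.sound (QuotientGroup.rightRel_apply.2 (by simp))

lemma rightCosetPart_mul (S : Subgroup G) (s : S) (g : G) :
    rightCosetPart S (s * g) = s * rightCosetPart S g := by
  ext
  simp [rightCosetPart, mk_rightRel_mul, mul_assoc]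

lemma rightCosetPart_out (S : Subgroup G) (c : Quotient (QuotientGroup.rightRel S)) :
    rightCosetPart S c.out = 1 := by
  ext
  simp [rightCosetPart]

/-- The defining relation of the coinvariants: a subgroup factor passes between the two tensor
factors. -/
lemma IndV.mk_mul {S : Subgroup G} (ρ : Representation k S A) (s : S) (g : G) (a : A) :
    IndV.mk S.subtype ρ (s * g) (ρ s a) = IndV.mk S.subtype ρ g a := by
  have := Coinvariants.mk_self_apply
    (Representation.tprod ((leftRegular k G).comp S.subtype) ρ) s
    (TensorProduct.tmul k (MonoidAlgebra.single g 1) a)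
  simpa using this

/-- The induced module is a direct sum of copies of the original one, indexed by right cosets. -/
noncomputable def indVLEquiv {S : Subgroup G} (ρ : Representation k S A) :
    IndV S.subtype ρ ≃ₗ[k] (Quotient (QuotientGroup.rightRel S) →₀ A) :=
  LinearEquiv.ofLinearMap
    -- With `g = s * r` and `r` the representative of its coset, `g ⊗ a` goes to `ρ s⁻¹ a` in the
    -- summand of that coset.
    (Coinvariants.lift _ (TensorProduct.lift (Finsupp.lsum k (fun g : G =>
        LinearMap.toSpanSingleton k _ (Finsupp.lsingle (Quotient.mk _ g) ∘ₗ
          ρ (rightCosetPart S g)⁻¹)) ∘ₗ (MonoidAlgebra.coeffLinearEquiv k).toLinearMap)) (by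
      intro s
      ext g a
      simp [rightCosetPart_mul, mk_rightRel_mul]))
    (Finsupp.lsum k fun c => IndV.mk S.subtype ρ c.out)
    (by
      ext c a
      simp [rightCosetPart_out])
    (by
      ext g a
      have h := IndV.mk_mul ρ (rightCosetPart S g) (Quotient.mk (QuotientGroup.rightRel S) g).out
        (ρ (rightCosetPart S g)⁻¹ a)
      rw [rightCosetPart_mul_out, self_inv_apply] at h
      simpa using h.symm)

lemma finrank_indV {k : Type*} [Field k] [Module k A] [Module.Finite k A]
    [Finite G] {S : Subgroup G}
    (ρ : Representation k S A) :
    Module.finrank k (IndV S.subtype ρ) = S.index * Module.finrank k A := by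
  have := Fintype.ofFinite (Quotient (QuotientGroup.rightRel S))
  rw [(indVLEquiv ρ).finrank_eq, (Finsupp.linearEquivFunOnFinite k A _).finrank_eq,
    Module.finrank_pi_fintype, Finset.sum_const, smul_eq_mul, Finset.card_univ, Subgroup.index,
    Nat.card_congr (QuotientGroup.quotientRightRelEquivQuotientLeftRel S).symm,
    Nat.card_eq_fintype_card]

end Representation

/-! ### Centralizer orders. -/

open scoped Nat

/-- The order of the centralizer of a permutation whose cycle lengths, fixed points included,
are the elements of `s`. -/
def centralizerOrder (s : Multiset ℕ) : ℕ := s.prod * ∏ i ∈ s.toFinset, (s.count i)!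

lemma centralizerOrder_eq_prod_of_subset {s : Multiset ℕ} {T : Finset ℕ} (h : s.toFinset ⊆ T) :
    centralizerOrder s = s.prod * ∏ i ∈ T, (s.count i)! := by
  rw [centralizerOrder, Finset.prod_subset h]
  intro i _ hi
  rw [Multiset.count_eq_zero.2 (by simpa using hi), Nat.factorial_zero]

/-- The new part contributes `i` to the product and raises one factorial by a step. -/
lemma centralizerOrder_cons (i : ℕ) (s : Multiset ℕ) :
    centralizerOrder (i ::ₘ s) = i * (s.count i + 1) * centralizerOrder s := by
  have hs : s.toFinset ⊆ (i ::ₘ s).toFinset := by simp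
  have hi : i ∈ (i ::ₘ s).toFinset := by simp
  rw [centralizerOrder_eq_prod_of_subset hs, centralizerOrder,
    ← Finset.mul_prod_erase _ _ hi, ← Finset.mul_prod_erase _ _ hi, Multiset.prod_cons,
    Multiset.count_cons_self, Nat.factorial_succ]
  have : ∏ j ∈ (i ::ₘ s).toFinset.erase i, ((i ::ₘ s).count j)! =
      ∏ j ∈ (i ::ₘ s).toFinset.erase i, (s.count j)! :=
    Finset.prod_congr rfl fun j hj => by
      rw [Multiset.count_cons_of_ne (Finset.ne_of_mem_erase hj)]
  rw [this]
  ring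

lemma Equiv.Perm.nat_card_centralizer_eq_centralizerOrder {α : Type*} [Fintype α] [DecidableEq α]
    (x : Equiv.Perm α) :
    Nat.card (Subgroup.centralizer {x}) = centralizerOrder x.partition.parts := by
  have h1 : (1 : ℕ) ∉ x.cycleType := fun h => absurd (two_le_of_mem_cycleType h) (by norm_num)
  have hsub : x.partition.parts.toFinset ⊆ insert 1 x.cycleType.toFinset := by
    intro i
    simp only [parts_partition, Multiset.mem_toFinset, Multiset.mem_add, Multiset.mem_replicate,
      Finset.mem_insert]
    tauto
  -- `cycleType` omits fixed points; they enter as parts of size 1 and account for the separate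
  -- factorial.
  rw [centralizerOrder_eq_prod_of_subset hsub, Finset.prod_insert (by simpa using h1),
    nat_card_centralizer, parts_partition, sum_cycleType, Multiset.prod_add,
    Multiset.prod_replicate, one_pow, Multiset.count_add, Multiset.count_eq_zero.2 h1,
    Multiset.count_replicate_self, zero_add]
  have : ∏ i ∈ x.cycleType.toFinset,
      ((x.cycleType + Multiset.replicate (Fintype.card α - x.support.card) 1).count i)! =
      ∏ i ∈ x.cycleType.toFinset, (x.cycleType.count i)! := by
    refine Finset.prod_congr rfl fun i hi => ?_
    have : i ≠ 1 := fun h => h1 (by simpa [h] using hi)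
    rw [Multiset.count_add, Multiset.count_replicate, if_neg this.symm, add_zero]
  rw [this]
  ring

lemma HigherLie.higherLieDim_mul_centralizerOrder {α : Type*} [Fintype α] [DecidableEq α]
    {ζ : ℕ → ℂ} (hζ : IsRootSystem ζ) (x : Equiv.Perm α) :
    higherLieDim hζ x * centralizerOrder x.partition.parts = (Fintype.card α)! := by
  have : higherLieDim hζ x = (Subgroup.centralizer {x}).index := by
    rw [higherLieDim, Representation.finrank_indV, Module.finrank_self, mul_one]
  rw [this, ← x.nat_card_centralizer_eq_centralizerOrder, Subgroup.index_mul_card,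
    Nat.card_perm, Nat.card_eq_fintype_card]

/-! ### Recursions for densities of cycle types. -/

namespace Nat.Partition

lemma centralizerOrder_pos {n : ℕ} (l : n.Partition) : 0 < centralizerOrder l.parts :=
  Nat.mul_pos (Nat.pos_of_ne_zero (Multiset.prod_ne_zero fun h => (l.parts_pos h).ne' rfl))
    (Finset.prod_pos fun _ _ => Nat.factorial_pos _)

/-- The proportion of the permutations of `n` letters all of whose cycle lengths satisfy `p`. -/
def cycleDensity (p : ℕ → Prop) [DecidablePred p] (n : ℕ) : ℚ :=
  ∑ l ∈ restricted n p, (centralizerOrder l.parts : ℚ)⁻¹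

variable (p : ℕ → Prop) [DecidablePred p]

lemma cycleDensity_zero : cycleDensity p 0 = 1 := by
  have : restricted 0 p = Finset.univ := by ext; simp [restricted]
  simp [cycleDensity, this, centralizerOrder]

lemma sum_range_count_mul {n : ℕ} (l : n.Partition) :
    ∑ j ∈ Finset.range n, l.parts.count (n - j) * (n - j) = n := by
  have h : l.parts.toFinset ⊆ Finset.Icc 1 n := fun i hi => by
    rw [Multiset.mem_toFinset] at hi
    exact Finset.mem_Icc.2 ⟨l.parts_pos hi, le_of_mem_parts hi⟩
  have h2 := l.parts_sum
  rw [Finset.sum_multiset_count_of_subset _ _ h] at h2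
  simp only [smul_eq_mul] at h2
  conv_rhs => rw [← h2]
  refine Finset.sum_bij' (fun j _ => n - j) (fun i _ => n - i) ?_ ?_ ?_ ?_ ?_ <;>
    simp only [Finset.mem_range, Finset.mem_Icc] <;> intros <;> first | omega | trivial

/-- Deleting one part `i` is a bijection onto the partitions of `n - i`, and the weight `count * i`
is exactly the factor by which the centralizer order drops. Partitions without the part `i` have
weight zero. -/
lemma sum_count_mul_inv_centralizerOrder {n i : ℕ} (h1 : 1 ≤ i) (hn : i ≤ n) (hp : p i) :
    ∑ l ∈ restricted n p, ((l.parts.count i * i : ℕ) : ℚ) * (centralizerOrder l.parts : ℚ)⁻¹ =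
      cycleDensity p (n - i) := by
  symm
  refine Finset.sum_of_injOn (fun m => ((partitionWithPartEquiv h1 hn).symm m).1) ?_ ?_ ?_ ?_
  · exact (Subtype.val_injective.comp (Equiv.injective _)).injOn
  · intro m hm
    simp only [restricted, Finset.coe_filter, Finset.mem_univ, true_and, Set.mem_ofPred_eq,
      partitionWithPartEquiv_symm_apply_parts, Multiset.mem_cons] at hm ⊢
    rintro j (rfl | hj)
    exacts [hp, hm j hj]
  · intro l hl hl'
    rw [Multiset.count_eq_zero.2, zero_mul, Nat.cast_zero, zero_mul]
    intro hi
    refine hl' ⟨partitionWithPartEquiv h1 hn ⟨l, hi⟩, ?_, by simp⟩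
    simp only [restricted, Finset.coe_filter, Finset.mem_univ, true_and, Set.mem_ofPred_eq,
      partitionWithPartEquiv_apply_parts, Finset.mem_filter] at hl ⊢
    exact fun j hj => hl j (Multiset.mem_of_mem_erase hj)
  · intro m _
    have h0 : (i : ℚ) ≠ 0 := by positivity
    have h2 : ((m.parts.count i : ℚ) + 1) ≠ 0 := by positivity
    rw [partitionWithPartEquiv_symm_apply_parts, centralizerOrder_cons, Multiset.count_cons_self]
    push_cast
    rw [mul_comm (i : ℚ), mul_inv, mul_inv_cancel_left₀ (mul_ne_zero h2 h0)]

/-- Write `n` as the sum of the parts of each partition and exchange sums; `j` is what remains after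
a part `n - j` is removed. -/
lemma mul_cycleDensity (n : ℕ) :
    (n : ℚ) * cycleDensity p n =
      ∑ j ∈ Finset.range n, if p (n - j) then cycleDensity p j else 0 := by
  have h (l : n.Partition) : (n : ℚ) * (centralizerOrder l.parts : ℚ)⁻¹ =
      ∑ j ∈ Finset.range n,
        ((l.parts.count (n - j) * (n - j) : ℕ) : ℚ) * (centralizerOrder l.parts : ℚ)⁻¹ := by
    rw [← Finset.sum_mul, ← Nat.cast_sum, sum_range_count_mul]
  rw [cycleDensity, Finset.mul_sum, Finset.sum_congr rfl fun l _ => h l, Finset.sum_comm]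
  refine Finset.sum_congr rfl fun j hj => ?_
  rw [Finset.mem_range] at hj
  split_ifs with hp
  · rw [sum_count_mul_inv_centralizerOrder p (by omega) (by omega) hp]
    congr 1
    omega
  · refine Finset.sum_eq_zero fun l hl => ?_
    rw [Multiset.count_eq_zero.2, zero_mul, Nat.cast_zero, zero_mul]
    exact fun hi => hp ((Finset.mem_filter.1 hl).2 _ hi)

/-- By periodicity the sum for `n + 2` repeats the one for `n`, apart from its last two terms, which
belong to part sizes 2 and 1. -/
lemma cycleDensity_add_two (hp : ∀ i, 0 < i → (p (i + 2) ↔ p i)) (n : ℕ) :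
    ((n + 2 : ℕ) : ℚ) * cycleDensity p (n + 2) = n * cycleDensity p n +
      (if p 2 then cycleDensity p n else 0) + if p 1 then cycleDensity p (n + 1) else 0 := by
  rw [mul_cycleDensity, mul_cycleDensity, Finset.sum_range_succ, Finset.sum_range_succ]
  congr 1
  · congr 1
    · refine Finset.sum_congr rfl fun j hj => ?_
      rw [Finset.mem_range] at hj
      rw [show n + 2 - j = n - j + 2 by omega]
      exact if_congr (hp _ (by omega)) rfl rfl
    · rw [Nat.add_sub_cancel_left]
  · rw [show n + 2 - (n + 1) = 1 by omega]

lemma cycleDensity_even_add_two (n : ℕ) :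
    ((n + 2 : ℕ) : ℚ) * cycleDensity Even (n + 2) = (n + 1 : ℕ) * cycleDensity Even n := by
  rw [cycleDensity_add_two Even (by simp [parity_simps])]
  simp
  ring

lemma cycleDensity_odd_add_two (n : ℕ) :
    ((n + 2 : ℕ) : ℚ) * cycleDensity (¬ Even ·) (n + 2) =
      n * cycleDensity (¬ Even ·) n + cycleDensity (¬ Even ·) (n + 1) := by
  rw [cycleDensity_add_two (¬ Even ·) (by simp [parity_simps])]
  simp

lemma cycleDensity_odd (m : ℕ) :
    cycleDensity (¬ Even ·) (2 * m) = cycleDensity Even (2 * m) ∧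
      cycleDensity (¬ Even ·) (2 * m + 1) = cycleDensity Even (2 * m) := by
  induction m with
  | zero =>
    have h := mul_cycleDensity (¬ Even ·) 1
    simp [cycleDensity_zero] at h
    simp [cycleDensity_zero, h]
  | succ m ih =>
    obtain ⟨h0, h1⟩ := ih
    have e0 := cycleDensity_odd_add_two (2 * m)
    have e1 := cycleDensity_odd_add_two (2 * m + 1)
    have e2 := cycleDensity_even_add_two (2 * m)
    have hm : (2 * m + 2 : ℚ) ≠ 0 := by positivity
    have hm' : (2 * m + 3 : ℚ) ≠ 0 := by positivity
    rw [h0, h1] at e0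
    rw [h1] at e1
    push_cast at e0 e1 e2
    -- With `e` the even density, both sides times `2m + 2` equal `(2m + 1) e(2m)`.
    have a : cycleDensity (¬ Even ·) (2 * m + 2) = cycleDensity Even (2 * m + 2) :=
      mul_left_cancel₀ hm (by linear_combination e0 - e2)
    rw [show 2 * m + 1 + 1 = 2 * m + 2 from rfl, a] at e1
    exact ⟨a, mul_left_cancel₀ hm' (by linear_combination e1 - e2)⟩

lemma factorial_mul_cycleDensity_even (m : ℕ) :
    ((2 * m)! : ℚ) * cycleDensity Even (2 * m) = ((2 * m - 1)‼ : ℚ) ^ 2 := by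
  induction m with
  -- Truncated subtraction makes the right side `0‼ ^ 2 = 1`.
  | zero => simp [cycleDensity_zero]
  | succ m ih =>
    have e := cycleDensity_even_add_two (2 * m)
    have hd : (2 * (m + 1) - 1)‼ = (2 * m + 1) * (2 * m - 1)‼ := by
      cases m with
      | zero => simp
      | succ m => exact Nat.doubleFactorial_add_two _
    rw [hd, show 2 * (m + 1) = 2 * m + 2 by ring, Nat.factorial_succ, Nat.factorial_succ]
    push_cast at e ⊢
    linear_combination (2 * m + 1 : ℚ) * ((2 * m)! : ℚ) * e + (2 * m + 1 : ℚ) ^ 2 * ih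

/-- The proportion of the permutations of `n` letters with one fixed point and all other cycles
of even length. -/
lemma sum_inv_centralizerOrder_evensPartition_odd (m : ℕ) :
    ∑ l ∈ evensPartition (2 * m + 1), (centralizerOrder l.parts : ℚ)⁻¹ =
      cycleDensity Even (2 * m) := by
  have hodd : ¬ Even (2 * m + 1) := by simp
  have h1 : 1 ≤ 2 * m + 1 := by omega
  have hcount (l : (2 * m).Partition) (hl : l ∈ restricted (2 * m) Even) :
      l.parts.count 1 = 0 := by
    rw [Multiset.count_eq_zero]
    intro h
    simpa using (Finset.mem_filter.1 hl).2 _ h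
  symm
  refine Finset.sum_of_injOn (fun l => ((partitionWithPartEquiv le_rfl h1).symm l).1) ?_ ?_ ?_ ?_
  · exact (Subtype.val_injective.comp (Equiv.injective _)).injOn
  · intro l hl
    simp only [evensPartition, if_neg hodd, Finset.coe_filter, Finset.mem_univ, true_and,
      Set.mem_ofPred_eq, partitionWithPartEquiv_symm_apply_parts, Multiset.mem_cons,
      Multiset.count_cons_self]
    refine ⟨by rw [hcount l hl], ?_⟩
    rintro i (rfl | hi) hne
    exacts [absurd rfl hne, (Finset.mem_filter.1 hl).2 i hi]
  · intro l hl hl'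
    simp only [evensPartition, if_neg hodd, Finset.mem_filter, Finset.mem_univ, true_and] at hl
    have hmem : 1 ∈ l.parts := Multiset.count_pos.1 (by omega)
    refine absurd ⟨partitionWithPartEquiv le_rfl h1 ⟨l, hmem⟩, ?_, by simp⟩ hl'
    simp only [restricted, Finset.coe_filter, Finset.mem_univ, true_and, Set.mem_ofPred_eq,
      partitionWithPartEquiv_apply_parts]
    intro i hi
    refine hl.2 i (Multiset.mem_of_mem_erase hi) ?_
    rintro rfl
    have := Multiset.count_pos.2 hi
    rw [Multiset.count_erase_self] at this
    omega
  · intro l hl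
    have := hcount l hl
    -- The adjoined fixed point multiplies the order by `1 * (0 + 1)`.
    rw [partitionWithPartEquiv_symm_apply_parts, centralizerOrder_cons]
    rw [show l.parts.count 1 = 0 from this]
    simp

end Nat.Partition

/-! ### From densities back to dimensions. -/

lemma HigherLie.sum_higherLieDim {n : ℕ} {ζ : ℕ → ℂ} (hζ : IsRootSystem ζ)
    {x : n.Partition → Equiv.Perm (Fin n)} (hx : ∀ l, (x l).partition.parts = l.parts)
    (s : Finset n.Partition) :
    ((∑ l ∈ s, higherLieDim hζ (x l) : ℕ) : ℚ) =
      (n ! : ℚ) * ∑ l ∈ s, (centralizerOrder l.parts : ℚ)⁻¹ := by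
  rw [Nat.cast_sum, Finset.mul_sum]
  refine Finset.sum_congr rfl fun l _ => ?_
  have h := higherLieDim_mul_centralizerOrder hζ (x l)
  rw [hx, Fintype.card_fin] at h
  have h0 : (centralizerOrder l.parts : ℚ) ≠ 0 := Nat.cast_ne_zero.2 l.centralizerOrder_pos.ne'
  rw [eq_mul_inv_iff_mul_eq₀ h0]
  exact_mod_cast h

open Nat.Partition in
theorem corollary1p5 (n : ℕ) (hn : 2 ≤ n)
    (ζ : ℕ → ℂ) (hζ : HigherLie.IsRootSystem ζ)
    (x : n.Partition → Equiv.Perm (Fin n)) (hx : ∀ l, (x l).partition.parts = l.parts) :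
    ∑ l ∈ Nat.Partition.odds n, HigherLie.higherLieDim hζ (x l)
        = ∑ l ∈ evensPartition n, HigherLie.higherLieDim hζ (x l) ∧
      ∑ l ∈ evensPartition n, HigherLie.higherLieDim hζ (x l)
        = if Even n then (n - 1).doubleFactorial ^ 2 else n.doubleFactorial * (n - 2).doubleFactorial := by
  have hO := HigherLie.sum_higherLieDim hζ hx (odds n)
  have hE := HigherLie.sum_higherLieDim hζ hx (evensPartition n)
  obtain ⟨m, rfl⟩ | ⟨m, rfl⟩ : (∃ m, n = 2 * m) ∨ ∃ m, n = 2 * m + 1 :=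
    exists_or.1 (Nat.even_or_odd' n)
  · have he : evensPartition (2 * m) = restricted (2 * m) Even := by
      ext
      simp [evensPartition, restricted]
    rw [he] at hE ⊢
    -- `odds` unfolds to `restricted` for the predicate `¬ Even ·`.
    change _ = _ * cycleDensity _ _ at hO
    change _ = _ * cycleDensity _ _ at hE
    rw [(cycleDensity_odd m).1] at hO
    refine ⟨Nat.cast_injective (R := ℚ) (hO.trans hE.symm), ?_⟩
    rw [if_pos (by simp)]
    rw [factorial_mul_cycleDensity_even] at hE
    exact_mod_cast hE
  · change _ = _ * cycleDensity _ _ at hO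
    rw [(cycleDensity_odd m).2] at hO
    rw [sum_inv_centralizerOrder_evensPartition_odd] at hE
    refine ⟨Nat.cast_injective (R := ℚ) (hO.trans hE.symm), ?_⟩
    rw [if_neg (by simp)]
    rw [Nat.factorial_succ, Nat.cast_mul, mul_assoc, factorial_mul_cycleDensity_even] at hE
    -- `n ≥ 2` excludes `m = 0`, so `n - 2` is not truncated.
    obtain ⟨k, rfl⟩ : ∃ k, m = k + 1 := ⟨m - 1, by omega⟩
    have hd : (2 * (k + 1) + 1)‼ = (2 * (k + 1) + 1) * (2 * k + 1)‼ :=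
      Nat.doubleFactorial_add_two (2 * k + 1)
    rw [show 2 * (k + 1) + 1 - 2 = 2 * k + 1 by omega, hd]
    rw [show 2 * (k + 1) - 1 = 2 * k + 1 by omega] at hE
    refine Nat.cast_injective (R := ℚ) (hE.trans ?_)
    push_cast
    ring
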